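/- Let $\mathcal{L}^-=\{0,1,\circ\}$ with constant symbols $0,1$ and a binary function symbol $\circ$ (written as juxtaposition), and let $\mathcal{L}=\{0,1,\circ,\preceq\}$, where $\preceq$ is a binary relation symbol. For a nonempty binary string $\alpha$ let $\overline{\alpha}$ be the closed term given by $\overline{\mathbf 0}=0$, $\overline{\mathbf 1}=1$, $\overline{\alpha\mathbf 0}=(\overline{\alpha}\circ 0)$, $\overline{\alpha\mathbf 1}=(\overline{\alpha}\circ 1)$, and let $\mathrm{Pref}(\alpha)$ and $\mathrm{Sub}(\alpha)$ be the sets of nonempty prefixes and of nonempty substrings of $\alpha$. Write $x\sqsubseteq_{\mathsf s}y$ for $x=y\vee\exists u v\,[\,y=ux\vee y=xv\vee y=uxv\,]$. $\mathsf{ID}$ is the $\mathcal{L}$-theory with the axioms 1. $\forall xyz\,[(xy)z=x(yz)]$, 2. $\forall xy\,[x\neq y\to(x0\neq y0\wedge x1\neq y1)]$, 3. $\forall xy\,[x0\neq y1]$, 4. $\forall x\,[x\preceq\overline{\alpha}\leftrightarrow\bigvee_{\gamma\in\mathrm{Pref}(\alpha)}x=\overline{\gamma}]$ for each nonempty binary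 string $\alpha$. $\mathsf{ID}^*$ is the $\mathcal{L}^-$-theory with the axioms 1, 2, 3 and $\forall x\,[x\sqsubseteq_{\mathsf s}\overline{\alpha}\to\bigvee_{\gamma\in\mathrm{Sub}(\alpha)}x=\overline{\gamma}]$ for each nonempty binary string $\alpha$. $\overline{\mathsf{ID}}$ and $\overline{\mathsf{ID}}^*$ are $\mathsf{ID}$ and $\mathsf{ID}^*$, respectively, extended with the two axioms $$\forall xy\,[x\neq y\to(0x\neq 0y\wedge 1x\neq 1y)],\qquad \forall xy\,[0x\neq 1y].$$ A relative translation $\tau$ (many-dimensional, parameter-free, one-piece) from a language $\mathcal{L}_1$ to a language $\mathcal{L}_2$ consists of a dimension $m\geq 1$, an $\mathcal{L}_2$-formula $\delta(\vec x)$ for the domain, an $\mathcal{L}_2$-formula $\psi_R(\vec x_1,\dots,\vec x_n)$ for each $n$-ary relation symbol $R$ (including equality), and an $\mathcal{L}_2$-formula $\psi_f(\vec x_1,\dots,\vec x_n,\vec y)$ for each $n$-ary function symbol $f$ (including constants), where all the vectors are $m$-tuples of variables; it extends to all formulas by unnesting terms, commuting with the connectives, and relativizing the quantifiers to $\delta$.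 It is an interpretation of $S$ in $T$ if $T$ proves $\exists\vec x\,\delta(\vec x)$, proves $\bigwedge_i\delta(\vec x_i)\to\exists!\vec y\,[\delta(\vec y)\wedge\psi_f(\vec x_1,\dots,\vec x_n,\vec y)]$ for each function or constant symbol $f$, and proves $\phi^\tau$ for each axiom $\phi$ of $S$ and each equality axiom $\phi$. (A theory proves a formula iff the formula holds in all its models, by completeness.) Two theories are mutually interpretable if each has an interpretation in the other. **Theorem.** $\overline{\mathsf{ID}}$ and $\overline{\mathsf{ID}}^*$ are mutually interpretable. Moreover, the same interpretations work as for $\mathsf{ID}$ and $\mathsf{ID}^*$: there is one relative translation that is both an interpretation of $\mathsf{ID}^*$ in $\mathsf{ID}$ and of $\overline{\mathsf{ID}}^*$ in $\overline{\mathsf{ID}}$, and there is one relative translation that is both an interpretation of $\mathsf{ID}$ in $\mathsf{ID}^*$ and of $\overline{\mathsf{ID}}$ in $\overline{\mathsf{ID}}^*$. -/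

import Mathlib

open FirstOrder FirstOrder.Language

/-! ## Relative translations and interpretations -/

namespace FirstOrder.Language

/-- A many-dimensional, parameter-free, one-piece relative translation from `L₁` to `L₂`.
Tuples of variables are indexed by `Fin dim`; the variable `(i, j)` is the `j`-th component of the
`i`-th tuple. Equality is treated as a binary relation symbol, constants as `0`-ary function
symbols. -/
structure RelTranslation (L₁ L₂ : Language.{0, 0}) where
  /-- the length `m` of the tuples -/
  dim : ℕ
  dim_pos : 0 < dim
  /-- the domain formula `δ(x₁, …, x_m)` -/
  dom : L₂.Formula (Fin dim)
  /-- the formula translating equality -/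
  eqv : L₂.Formula (Fin 2 × Fin dim)
  /-- the formula translating a relation symbol -/
  rel : ∀ {n : ℕ}, L₁.Relations n → L₂.Formula (Fin n × Fin dim)
  /-- the formula `ψ_f(x⃗₁, …, x⃗ₙ, y⃗)` translating a function symbol; the tuple `y⃗` is given by the
  variables `Sum.inr j` -/
  fn : ∀ {n : ℕ}, L₁.Functions n → L₂.Formula ((Fin n × Fin dim) ⊕ Fin dim)

namespace RelTranslation

variable {L₁ L₂ : Language.{0, 0}} (τ : RelTranslation L₁ L₂)

/-- `δ(x⃗)` for the tuple of variables `x`. -/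
def domAt {V : Type} (x : Fin τ.dim → V) : L₂.Formula V :=
  τ.dom.relabel x

/-- The translation `(t)^{τ, w⃗}` of a term, a formula saying that the tuple `w⃗` (the variables
`Sum.inr j`) denotes the value of `t`. A variable `x` of `t` becomes the tuple `(x, j)`. -/
noncomputable def term {V : Type} : L₁.Term V → L₂.Formula ((V × Fin τ.dim) ⊕ Fin τ.dim)
  | .var x =>
      Formula.iInf fun j : Fin τ.dim =>
        Term.equal (L := L₂) (Term.var (Sum.inr j)) (Term.var (Sum.inl (x, j)))
  | .func (l := n) f ts =>
      Formula.iExs (Fin n × Fin τ.dim)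
        ((Formula.iInf fun i : Fin n => τ.domAt fun j => Sum.inr (i, j)) ⊓
          (Formula.iInf fun i : Fin n =>
            (term (ts i)).relabel
              (Sum.elim (fun p => Sum.inl (Sum.inl p)) fun j => Sum.inr (i, j))) ⊓
          (τ.fn f).relabel (Sum.elim Sum.inr fun j => Sum.inl (Sum.inr j)))

/-- The translation
`∃ v⃗₁ … v⃗ₙ [⋀ δ(v⃗ᵢ) ∧ ⋀ (tᵢ)^{τ, v⃗ᵢ} ∧ ψ(v⃗₁, …, v⃗ₙ)]` of an atomic formula with arguments
`t₁, …, tₙ`, where `ψ` translates its relation symbol. -/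
noncomputable def atomic {V : Type} {n : ℕ} (ψ : L₂.Formula (Fin n × Fin τ.dim))
    (ts : Fin n → L₁.Term V) : L₂.Formula (V × Fin τ.dim) :=
  Formula.iExs (Fin n × Fin τ.dim)
    ((Formula.iInf fun i : Fin n => τ.domAt fun j => Sum.inr (i, j)) ⊓
      (Formula.iInf fun i : Fin n =>
        (τ.term (ts i)).relabel (Sum.elim Sum.inl fun j => Sum.inr (i, j))) ⊓
      ψ.relabel Sum.inr)

/-- Splits off the tuple of the last (most recently bound) variable. -/
def splitLast {V : Type} {n m : ℕ} :
    (V ⊕ Fin (n + 1)) × Fin m → ((V ⊕ Fin n) × Fin m) ⊕ Fin m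
  | (Sum.inl x, j) => Sum.inl (Sum.inl x, j)
  | (Sum.inr i, j) =>
      Fin.lastCases (motive := fun _ => ((V ⊕ Fin n) × Fin m) ⊕ Fin m)
        (Sum.inr j) (fun i => Sum.inl (Sum.inr i, j)) i

/-- The translation `φ ↦ φ^τ`: it commutes with the propositional connectives, and a quantifier
becomes a block of quantifiers relativized to the domain. -/
noncomputable def formula {V : Type} :
    {n : ℕ} → L₁.BoundedFormula V n → L₂.Formula ((V ⊕ Fin n) × Fin τ.dim)
  | _, .falsum => ⊥
  | _, .equal t₁ t₂ => τ.atomic τ.eqv ![t₁, t₂]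
  | _, .rel R ts => τ.atomic (τ.rel R) ts
  | _, .imp φ ψ => (formula φ).imp (formula ψ)
  | _, .all φ =>
      Formula.iAlls (Fin τ.dim)
        ((τ.domAt Sum.inr).imp ((formula φ).relabel splitLast))

end RelTranslation

/-- The equality axioms of a language: reflexivity, symmetry, transitivity, and congruence for all
function and relation symbols. -/
inductive EqualityAxiom (L : Language.{0, 0}) : L.Sentence → Prop
  | refl : EqualityAxiom L (∀' ((&0 : L.Term (Empty ⊕ Fin 1)) =' &0))
  | symm : EqualityAxiom L
      (∀' ∀' (((&0 : L.Term (Empty ⊕ Fin 2)) =' &1) ⟹ ((&1 : L.Term (Empty ⊕ Fin 2)) =' &0)))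
  | trans : EqualityAxiom L
      (∀' ∀' ∀' (((&0 : L.Term (Empty ⊕ Fin 3)) =' &1) ⟹
        (((&1 : L.Term (Empty ⊕ Fin 3)) =' &2) ⟹ ((&0 : L.Term (Empty ⊕ Fin 3)) =' &2))))
  | fn {n : ℕ} (f : L.Functions n) : EqualityAxiom L
      (Formula.iAlls (α := Empty) (Fin 2 × Fin n)
        ((Formula.iInf fun i : Fin n =>
            Term.equal (L := L) (Term.var (Sum.inr (0, i))) (Term.var (Sum.inr (1, i)))).imp
          (Term.equal (Term.func f fun i => Term.var (Sum.inr (0, i)))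
            (Term.func f fun i => Term.var (Sum.inr (1, i))))))
  | rel {n : ℕ} (R : L.Relations n) : EqualityAxiom L
      (Formula.iAlls (α := Empty) (Fin 2 × Fin n)
        ((Formula.iInf fun i : Fin n =>
            Term.equal (L := L) (Term.var (Sum.inr (0, i))) (Term.var (Sum.inr (1, i)))).imp
          ((R.formula fun i => Term.var (Sum.inr (0, i))).imp
            (R.formula fun i => Term.var (Sum.inr (1, i))))))

/-- `τ` is a relative interpretation of the theory `S` in the theory `T`. Here `T ⊨ᵇ φ` says that
`φ` is a theorem of `T` (true in all nonempty models of `T` under all assignments). The translated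
equality axioms are required throughout; they hold automatically if equality is translated as
equality. -/
structure RelTranslation.Interprets {L₁ L₂ : Language.{0, 0}} (τ : RelTranslation L₁ L₂)
    (S : L₁.Theory) (T : L₂.Theory) : Prop where
  dom_nonempty : T ⊨ᵇ Formula.iExs (α := Empty) (Fin τ.dim) (τ.domAt Sum.inr)
  fn_total : ∀ {n : ℕ} (f : L₁.Functions n),
    T ⊨ᵇ (Formula.iInf fun i : Fin n => τ.domAt fun j => (i, j)).imp
      (Formula.iExsUnique (α := Fin n × Fin τ.dim) (Fin τ.dim) (τ.domAt Sum.inr ⊓ τ.fn f))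
  equality : ∀ φ : L₁.Sentence, EqualityAxiom L₁ φ → T ⊨ᵇ τ.formula φ
  axioms : ∀ φ ∈ S, T ⊨ᵇ τ.formula φ

/-- `S` is (relatively) interpretable in `T`. -/
def Interpretable {L₁ L₂ : Language.{0, 0}} (S : L₁.Theory) (T : L₂.Theory) : Prop :=
  ∃ τ : RelTranslation L₁ L₂, τ.Interprets S T

/-- `S` and `T` are mutually interpretable. -/
def MutuallyInterpretable {L₁ L₂ : Language.{0, 0}} (S : L₁.Theory) (T : L₂.Theory) : Prop :=
  Interpretable S T ∧ Interpretable T S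

end FirstOrder.Language

/-! ## Theories of concatenation -/

namespace Concatenation

/-- The function symbols `0`, `1`, `∘`. -/
inductive Func : ℕ → Type
  | zero : Func 0
  | one : Func 0
  | conc : Func 2

/-- The relation symbol `≼`. -/
inductive Rel : ℕ → Type
  | pref : Rel 2

/-- The language `{0, 1, ∘}`. -/
def LMinus : FirstOrder.Language.{0, 0} := ⟨Func, fun _ => Empty⟩

/-- The language `{0, 1, ∘, ≼}`. -/
def LPref : FirstOrder.Language.{0, 0} := ⟨Func, Rel⟩

/-- A language that contains the symbols `0`, `1`, `∘`. -/
class HasConc (L : FirstOrder.Language.{0, 0}) where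
  sym : ∀ {n : ℕ}, Func n → L.Functions n

instance : HasConc LMinus := ⟨fun f => f⟩

instance : HasConc LPref := ⟨fun f => f⟩

/-- Nonempty binary strings; `false` is the letter `0` and `true` the letter `1`. -/
abbrev BitString : Type := {l : List Bool // l ≠ []}

section Terms

variable {L : FirstOrder.Language.{0, 0}} [HasConc L] {V : Type}

/-- The constant `0` or `1`. -/
def bit (b : Bool) : L.Term V :=
  Term.func (HasConc.sym (if b then Func.one else Func.zero)) ![]

/-- The term `s ∘ t`. -/
def cat (s t : L.Term V) : L.Term V :=
  Term.func (HasConc.sym Func.conc) ![s, t]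

/-- The biteral of a nonempty string, associated to the left: the biteral of `αb` is the biteral of
`α` concatenated with `b`. -/
def biteral (α : BitString) : L.Term V :=
  α.1.tail.foldl (fun t b => cat t (bit b)) (bit (α.1.head α.2))

end Terms

/-- The nonempty prefixes of `α`. -/
abbrev Pref (α : BitString) : Type := {γ : BitString // γ.1 <+: α.1}

/-- The nonempty substrings of `α`. -/
abbrev Sub (α : BitString) : Type := {γ : BitString // γ.1 <:+: α.1}

instance (α : BitString) : Finite (Sub α) :=
  Finite.of_injective (β := {l // l ∈ α.1.sublists})
    (fun γ => ⟨γ.1.1, List.mem_sublists.2 γ.2.sublist⟩)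
    fun _ _ h => Subtype.ext (Subtype.ext (Subtype.mk.inj h))

instance (α : BitString) : Finite (Pref α) :=
  Finite.of_injective (β := Sub α) (fun γ => ⟨γ.1, γ.2.isInfix⟩)
    fun _ _ h => Subtype.ext (Subtype.mk.inj h)

section Axioms

variable (L : FirstOrder.Language.{0, 0}) [HasConc L]

/-- `∀ x y z [(xy)z = x(yz)]` -/
def assoc : L.Sentence :=
  ∀' ∀' ∀' (cat (cat (&0) (&1)) (&2) =' cat (&0) (cat (&1) (&2)))

/-- `∀ x y [x ≠ y → (x0 ≠ y0 ∧ x1 ≠ y1)]` -/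
def rightCancel : L.Sentence :=
  ∀' ∀' (∼((&0) =' (&1)) ⟹
    (∼(cat (&0) (bit false) =' cat (&1) (bit false)) ⊓
      ∼(cat (&0) (bit true) =' cat (&1) (bit true))))

/-- `∀ x y [x0 ≠ y1]` -/
def rightDistinct : L.Sentence :=
  ∀' ∀' ∼(cat (&0) (bit false) =' cat (&1) (bit true))

/-- `∀ x y [x ≠ y → (0x ≠ 0y ∧ 1x ≠ 1y)]` -/
def leftCancel : L.Sentence :=
  ∀' ∀' (∼((&0) =' (&1)) ⟹
    (∼(cat (bit false) (&0) =' cat (bit false) (&1)) ⊓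
      ∼(cat (bit true) (&0) =' cat (bit true) (&1))))

/-- `∀ x y [0x ≠ 1y]` -/
def leftDistinct : L.Sentence :=
  ∀' ∀' ∼(cat (bit false) (&0) =' cat (bit true) (&1))

/-- The three axioms common to both theories. -/
def base : L.Theory := {assoc L, rightCancel L, rightDistinct L}

/-- The two axioms that are added. -/
def leftAxioms : L.Theory := {leftCancel L, leftDistinct L}

end Axioms

/-- `∀ x [x ≼ α ↔ ⋁ {x = γ : γ a nonempty prefix of α}]` -/
noncomputable def prefixAxiom (α : BitString) : LPref.Sentence :=
  ∀' ((Relations.boundedFormula₂ (L := LPref) Rel.pref (&0) (biteral α)).iff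
    (BoundedFormula.iSup fun γ : Pref α => (&0) =' biteral γ.1))

/-- `x ⊑ α`, where `x` is the bound variable `&0`:
`x = α ∨ ∃ u v [α = ux ∨ α = xv ∨ α = uxv]` -/
def substringFormula (α : BitString) : LMinus.BoundedFormula Empty 1 :=
  ((&0) =' biteral α) ⊔
    ∃' ∃' ((biteral α =' cat (&1) (&0)) ⊔ (biteral α =' cat (&0) (&2)) ⊔
      (biteral α =' cat (cat (&1) (&0)) (&2)))

/-- `∀ x [x ⊑ α → ⋁ {x = γ : γ a nonempty substring of α}]` -/
noncomputable def substringAxiom (α : BitString) : LMinus.Sentence :=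
  ∀' (substringFormula α ⟹ BoundedFormula.iSup fun γ : Sub α => (&0) =' biteral γ.1)

/-- The theory `ID`. -/
def ID : LPref.Theory := base LPref ∪ Set.range prefixAxiom

/-- The theory `ID*`. -/
def IDStar : LMinus.Theory := base LMinus ∪ Set.range substringAxiom

/-- The theory `ID` with left cancellation. -/
def IDBar : LPref.Theory := ID ∪ leftAxioms LPref

/-- The theory `ID*` with left cancellation. -/
def IDBarStar : LMinus.Theory := IDStar ∪ leftAxioms LMinus

end Concatenation

/-! Call the value of a string standard. In both theories the last letter of a product with a
letter, and what precedes it, are determined (`RightFree`); with associativity this makes distinct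
strings have distinct values (`value_injective`).

To interpret `ID` in `ID*`, keep all elements and read x ≼ y as: x = y, or y = xv for some v. If the
value of α is xv, the substring axiom makes x and v standard, and by injectivity their strings
concatenate to α (`eq_or_exists_mul_iff`).

To interpret `ID*` in `ID`, the obstacle is that a standard element may have nonstandard factors,
while ≼ is controlled only below standard elements. The domain therefore shrinks to the tame
elements: x such that u ≼ ux and x can be stripped letter by letter, whenever ux is regular and u
ends in a letter. Regularity is a first-order condition that holds for all standard elements and
collects what is needed for letters to be tame (`tame_letter`) and for tameness to be closed under
products (`Tame.mul`). If the value of α is ux with u and x tame, then u ≼ ux, so u is the value of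
a prefix by the prefix axiom. Also x is strippable, and removing letters from x and α in parallel
shows that x is the value of a suffix (`Strippable.exists_value_of_le`). For uxv, split off v and
then u.

Both translations keep the operations, on the whole structure or on a substructure. The two left
axioms are universal, so they carry over and the same translations serve the extended theories. The
verification is semantic: it suffices to find the inner model in each model
(`interprets_of_isInnerModel`). -/

namespace Concatenation

/-- Induction on nonempty strings by appending letters on the right. -/
theorem BitString.snoc_induction {P : BitString → Prop}
    (single : ∀ b, P ⟨[b], List.cons_ne_nil _ _⟩)
    (snoc : ∀ (α : BitString) (b : Bool), P α → P ⟨α.1 ++ [b], by simp⟩) (α : BitString) : P α := by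
  obtain ⟨l, hl⟩ := α
  induction l using List.reverseRecOn with
  | nil => exact absurd rfl hl
  | append_singleton l b ih =>
    by_cases h : l = []
    · subst h; exact single b
    · exact snoc ⟨l, h⟩ b (ih h)

/-! ### Stripping, regularity and tameness in a structure with one operation. -/

section Mul

variable {M : Type} [Mul M] (c : Bool → M)

/-- The value of a nonempty string when the letters are interpreted by `c`. -/
def value (α : BitString) : M :=
  α.1.tail.foldl (fun t b => t * c b) (c (α.1.head α.2))

/-- Appending letters on the right is jointly injective. -/
structure RightFree : Prop where
  cancel : ∀ {x y : M} {b : Bool}, x * c b = y * c b → x = y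
  distinct : ∀ x y : M, x * c false ≠ y * c true

/-- The last letter of `x` exists. -/
def EndsInLetter (x : M) : Prop := ∃ b, x = c b ∨ ∃ z, x = z * c b

variable (le : M → M → Prop)

/-- The elements below `x` can be stripped letter by letter, and `x` is one of them. -/
def Strippable (x : M) : Prop :=
  le x x ∧ ∀ z, le z x → ∃ b, z = c b ∨ ∃ w, le w x ∧ z = w * c b

/-- Local properties of the prefix relation below `v` that hold if `v` is the value of a string. -/
def LocallyRegular (v : M) : Prop :=
  (∀ u t, le u v → le t u → le t v) ∧
  (∀ u, EndsInLetter c u → (∃ b, v = u * c b) → le u v) ∧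
  (∀ u x y, v = u * x * y → le (u * x) v → Strippable c le x → Strippable c le y →
    Strippable c le (x * y))

/-- `y` and all elements below it are locally regular. -/
def Regular (y : M) : Prop :=
  LocallyRegular c le y ∧ ∀ v, le v y → LocallyRegular c le v

/-- The elements that can be split off on the right of any regular element. -/
def Tame (x : M) : Prop :=
  EndsInLetter c x ∧
    ∀ u, EndsInLetter c u → Regular c le (u * x) → le u (u * x) ∧ Strippable c le x

end Mul

/-! ### Values of strings in right-free semigroups. -/

section Semigroup

variable {M : Type} [Semigroup M] (c : Bool → M)

theorem value_snoc (α : BitString) (b : Bool) (h : α.1 ++ [b] ≠ []) :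
    value c ⟨α.1 ++ [b], h⟩ = value c α * c b := by
  obtain ⟨l, hl⟩ := α
  cases l with
  | nil => exact absurd rfl hl
  | cons a l => simp [value, List.foldl_append]

theorem value_append (α β : BitString) (h : α.1 ++ β.1 ≠ []) :
    value c ⟨α.1 ++ β.1, h⟩ = value c α * value c β := by
  induction β using BitString.snoc_induction with
  | single b => exact value_snoc c α b h
  | snoc β b ih =>
    have hne : α.1 ++ β.1 ≠ [] := by simp [α.2]
    rw [value_snoc c β b, ← mul_assoc, ← ih hne, ← value_snoc c ⟨α.1 ++ β.1, hne⟩ b (by simp)]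
    simp only [List.append_assoc]

variable {c}

theorem EndsInLetter.mul_left {x : M} (hx : EndsInLetter c x) (u : M) :
    EndsInLetter c (u * x) := by
  obtain ⟨b, rfl | ⟨z, rfl⟩⟩ := hx
  · exact ⟨b, Or.inr ⟨u, rfl⟩⟩
  · exact ⟨b, Or.inr ⟨u * z, (mul_assoc _ _ _).symm⟩⟩

theorem endsInLetter_value (α : BitString) : EndsInLetter c (value c α) := by
  induction α using BitString.snoc_induction with
  | single b => exact ⟨b, Or.inl rfl⟩
  | snoc α b _ => exact ⟨b, Or.inr ⟨value c α, value_snoc c α b _⟩⟩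

namespace RightFree

variable (hc : RightFree c)
include hc

theorem letter_eq {x y : M} {a b : Bool} (h : x * c a = y * c b) : a = b := by
  cases a <;> cases b
  · rfl
  · exact absurd h (hc.distinct _ _)
  · exact absurd h.symm (hc.distinct _ _)
  · rfl

theorem letter_injective {a b : Bool} (h : c a = c b) : a = b :=
  hc.letter_eq (x := c a) (y := c a) (by rw [h])

/-- Choose y ending in the letter opposite to the last letter of x: then yx and y end differently.
So x is not a right identity. -/
theorem exists_mul_ne {x : M} (hx : EndsInLetter c x) : ∃ y, y * x ≠ y := by
  obtain ⟨b, hb⟩ := hx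
  refine ⟨c b * c (!b), fun h => ?_⟩
  obtain ⟨w, hw⟩ : ∃ w, c b * c (!b) * x = w * c b := by
    rcases hb with rfl | ⟨z, rfl⟩
    · exact ⟨_, rfl⟩
    · exact ⟨_, (mul_assoc _ _ _).symm⟩
  have := hc.letter_eq (hw.symm.trans h)
  cases b <;> simp at this

/-- A letter is not a proper extension of an element that ends in a letter. -/
theorem mul_letter_ne {x : M} (hx : EndsInLetter c x) (a b : Bool) : x * c b ≠ c a := by
  intro h
  -- Right-freeness compares products only, so both sides are first multiplied on the left by `c a`.
  obtain rfl : b = a := hc.letter_eq (x := c a * x) (y := c a) (by rw [mul_assoc, h])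
  obtain ⟨y, hy⟩ := hc.exists_mul_ne hx
  -- Cancelling the letter would make `x` a right identity.
  exact hy (hc.cancel (b := b) (by rw [mul_assoc, h]))

/-- Last letters are compared and removed in parallel. If one string runs out first, a letter equals
a proper extension of a value, which `mul_letter_ne` excludes. -/
theorem value_injective : Function.Injective (value c) := by
  intro α
  induction α using BitString.snoc_induction with
  | single a =>
    intro β
    induction β using BitString.snoc_induction with
    | single b => intro h; cases hc.letter_injective h; rfl
    | snoc β b _ =>
      intro h
      rw [value_snoc] at h
      exact absurd h.symm (hc.mul_letter_ne (endsInLetter_value β) _ _)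
  | snoc α a ih =>
    intro β
    induction β using BitString.snoc_induction with
    | single b =>
      intro h
      rw [value_snoc] at h
      exact absurd h (hc.mul_letter_ne (endsInLetter_value α) _ _)
    | snoc β b _ =>
      intro h
      rw [value_snoc, value_snoc] at h
      cases hc.letter_eq h
      cases ih (hc.cancel h)
      rfl

/-- If every substring of (the value of) a string is the value of a substring, then the prefixes of
a string are the values of its prefixes. -/
theorem eq_or_exists_mul_iff
    (hsub : ∀ (α : BitString) (x : M),
      (x = value c α ∨ ∃ u v, value c α = u * x ∨ value c α = x * v ∨ value c α = u * x * v) →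
        ∃ γ : Sub α, x = value c γ.1)
    (α : BitString) (x : M) :
    (x = value c α ∨ ∃ v, value c α = x * v) ↔ ∃ γ : Pref α, x = value c γ.1 := by
  constructor
  · rintro (rfl | ⟨v, hv⟩)
    · exact ⟨⟨α, List.prefix_rfl⟩, rfl⟩
    · obtain ⟨γ, rfl⟩ := hsub α x (Or.inr ⟨v, v, Or.inr (Or.inl hv)⟩)
      obtain ⟨δ, rfl⟩ := hsub α v (Or.inr ⟨_, v, Or.inl hv⟩)
      have hne : γ.1.1 ++ δ.1.1 ≠ [] := by simp [γ.1.2]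
      rw [← value_append c γ.1 δ.1 hne] at hv
      have := hc.value_injective hv
      exact ⟨⟨γ.1, ⟨δ.1.1, (congrArg Subtype.val this).symm⟩⟩, rfl⟩
  · rintro ⟨⟨γ, δ, hδ⟩, rfl⟩
    -- The empty remainder has no value, so this case lands in the equality disjunct.
    by_cases h : δ = []
    · subst h
      exact Or.inl (congrArg _ (Subtype.ext (by simpa using hδ)))
    · refine Or.inr ⟨value c ⟨δ, h⟩, ?_⟩
      rw [← value_append c γ ⟨δ, h⟩ (by simp [h])]
      exact congrArg _ (Subtype.ext hδ.symm)

end RightFree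

/-! ### Tame elements: closure under products, and factors of standard elements. -/

section Tame

variable {le : M → M → Prop}

/-- The transitivity clause of local regularity at y puts everything below v also below y. -/
theorem Regular.of_le {v y : M} (hy : Regular c le y) (h : le v y) : Regular c le v :=
  ⟨hy.2 v h, fun w hw => hy.2 w (hy.1.1 v w h hw)⟩

/-- Rebracket u(xy) as (ux)y. Tameness of y gives ux ≼ uxy, so ux is again regular and tameness of x
applies to it. The first and third clauses of local regularity at uxy then combine the two
conclusions. -/
theorem Tame.mul {x y : M} (hx : Tame c le x) (hy : Tame c le y) : Tame c le (x * y) := by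
  refine ⟨hy.1.mul_left x, fun u hu hreg => ?_⟩
  rw [← mul_assoc] at hreg ⊢
  obtain ⟨h1, h2⟩ := hy.2 _ (hx.1.mul_left u) hreg
  obtain ⟨h3, h4⟩ := hx.2 _ hu (hreg.of_le h1)
  exact ⟨hreg.1.1 _ _ h1 h3, hreg.1.2.2 u x y rfl h1 h4 h2⟩

theorem Strippable.endsInLetter_of_le {x z : M} (hx : Strippable c le x) (hz : le z x) :
    EndsInLetter c z := by
  obtain ⟨b, h | ⟨w, -, h⟩⟩ := hx.2 z hz
  exacts [⟨b, Or.inl h⟩, ⟨b, Or.inr ⟨w, h⟩⟩]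

/-- A strippable right factor of the value of a string is the value of a suffix. -/
theorem Strippable.exists_value_of_le (hc : RightFree c) {x : M} (hx : Strippable c le x)
    (α : BitString) {u z : M} (hz : le z x) (h : value c α = u * z) :
    ∃ γ : BitString, γ.1 <:+ α.1 ∧ z = value c γ := by
  -- The induction is on the actual string α, so stripping ends even though z is not yet known to be
  -- standard. The bound x stays fixed, since each remainder of z is again below x.
  induction α using BitString.snoc_induction generalizing z with
  | single a =>
    obtain ⟨b, rfl | ⟨w, hw, rfl⟩⟩ := hx.2 z hz
    · obtain rfl : a = b := hc.letter_eq (x := c a) (y := c a * u) (by rw [mul_assoc, ← h]; rfl)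
      exact ⟨⟨[a], _⟩, List.suffix_rfl, rfl⟩
    · rw [← mul_assoc] at h
      exact absurd h.symm (hc.mul_letter_ne ((hx.endsInLetter_of_le hw).mul_left u) _ _)
  | snoc α a ih =>
    rw [value_snoc] at h
    obtain ⟨b, rfl | ⟨w, hw, rfl⟩⟩ := hx.2 z hz
    · obtain rfl := hc.letter_eq h
      exact ⟨⟨[a], List.cons_ne_nil _ _⟩, List.suffix_append _ _, rfl⟩
    · rw [← mul_assoc] at h
      obtain rfl := hc.letter_eq h
      obtain ⟨γ, hγ, rfl⟩ := ih hw (hc.cancel h)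
      refine ⟨⟨γ.1 ++ [a], by simp⟩, ?_, (value_snoc c γ a _).symm⟩
      obtain ⟨t, ht⟩ := hγ
      exact ⟨t, by simp [← ht]⟩

section PrefixValues

variable (hle : ∀ (α : BitString) (x : M), le x (value c α) ↔ ∃ γ : Pref α, x = value c γ.1)
include hle

theorem strippable_value (α : BitString) : Strippable c le (value c α) := by
  refine ⟨(hle _ _).2 ⟨⟨α, List.prefix_rfl⟩, rfl⟩, fun z hz => ?_⟩
  obtain ⟨⟨γ, hγ⟩, rfl⟩ := (hle _ _).1 hz
  induction γ using BitString.snoc_induction with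
  | single b => exact ⟨b, Or.inl rfl⟩
  | snoc γ b _ =>
    exact ⟨b, Or.inr ⟨value c γ, (hle _ _).2 ⟨⟨γ, (List.prefix_append _ _).trans hγ⟩, rfl⟩,
      value_snoc c γ b _⟩⟩

/-- The second clause of local regularity is there for this case; strippability holds because a
letter is standard. -/
theorem tame_letter (b : Bool) : Tame c le (c b) :=
  ⟨⟨b, Or.inl rfl⟩, fun u hu hreg => ⟨hreg.1.2.1 u hu ⟨b, rfl⟩,
    strippable_value hle ⟨[b], List.cons_ne_nil _ _⟩⟩⟩

variable (hc : RightFree c)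
include hc

/-- The first clause is transitivity of the prefix relation on strings. For the third, ux is the
value of a prefix γ; stripping x off γ and y off α makes both standard, hence xy is standard and
strippable. -/
theorem locallyRegular_value (α : BitString) : LocallyRegular c le (value c α) := by
  refine ⟨fun u t hu ht => ?_, fun u hu ⟨b, hb⟩ => ?_, fun u x y h hux hx hy => ?_⟩
  · obtain ⟨γ, rfl⟩ := (hle _ _).1 hu
    obtain ⟨δ, rfl⟩ := (hle _ _).1 ht
    exact (hle _ _).2 ⟨⟨δ.1, δ.2.trans γ.2⟩, rfl⟩
  · induction α using BitString.snoc_induction with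
    -- This is where `u` must end in a letter: the axioms of `base` allow an empty string, which
    -- would satisfy the equation.
    | single a => exact absurd hb.symm (hc.mul_letter_ne hu _ _)
    | snoc α a _ =>
      rw [value_snoc] at hb
      obtain rfl := hc.letter_eq hb
      obtain rfl := hc.cancel hb
      exact (hle _ _).2 ⟨⟨α, List.prefix_append _ _⟩, rfl⟩
  · obtain ⟨γ, hγ⟩ := (hle _ _).1 hux
    obtain ⟨δ, -, rfl⟩ := hx.exists_value_of_le hc γ.1 hx.1 hγ.symm
    obtain ⟨ε, -, rfl⟩ := hy.exists_value_of_le hc α hy.1 h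
    rw [← value_append c δ ε (by simp [δ.2])]
    exact strippable_value hle _

theorem regular_value (α : BitString) : Regular c le (value c α) := by
  refine ⟨locallyRegular_value hle hc α, fun v hv => ?_⟩
  obtain ⟨γ, rfl⟩ := (hle _ _).1 hv
  exact locallyRegular_value hle hc γ.1

/-- If the product of two tame elements is the value of a string, then the left factor is the value
of a prefix. -/
theorem Tame.exists_value_left {u x : M} (hu : Tame c le u) (hx : Tame c le x) (α : BitString)
    (h : value c α = u * x) : ∃ γ : Pref α, u = value c γ.1 := by
  refine (hle α u).1 ?_
  rw [h]
  exact (hx.2 u hu.1 (h ▸ regular_value hle hc α)).1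

/-- If the product of two tame elements is the value of a string, then the right factor is the
value of a suffix. -/
theorem Tame.exists_value_right {u x : M} (hu : Tame c le u) (hx : Tame c le x) (α : BitString)
    (h : value c α = u * x) : ∃ γ : BitString, γ.1 <:+ α.1 ∧ x = value c γ := by
  have hs := (hx.2 u hu.1 (h ▸ regular_value hle hc α)).2
  exact hs.exists_value_of_le hc α hs.1 h

/-- Substrings, among the tame elements, of the value of a string are values of substrings. -/
theorem Tame.exists_value_of_substring {x : M} (hx : Tame c le x) (α : BitString)
    (h : x = value c α ∨ ∃ u v, Tame c le u ∧ Tame c le v ∧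
      (value c α = u * x ∨ value c α = x * v ∨ value c α = u * x * v)) :
    ∃ γ : Sub α, x = value c γ.1 := by
  rcases h with rfl | ⟨u, v, hu, hv, h | h | h⟩
  · exact ⟨⟨α, List.infix_rfl⟩, rfl⟩
  · obtain ⟨γ, hγ, rfl⟩ := hu.exists_value_right hle hc hx α h
    exact ⟨⟨γ, hγ.isInfix⟩, rfl⟩
  · obtain ⟨γ, rfl⟩ := hx.exists_value_left hle hc hv α h
    exact ⟨⟨γ.1, γ.2.isInfix⟩, rfl⟩
  -- Closure under products makes `u * x` a tame left factor, hence the value of a prefix `γ`; then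
  -- `x` is split off on the right of `γ`.
  · obtain ⟨γ, hγ⟩ := (hu.mul hx).exists_value_left hle hc hv α h
    obtain ⟨δ, hδ, rfl⟩ := hu.exists_value_right hle hc hx γ.1 hγ.symm
    exact ⟨⟨δ, hδ.isInfix.trans γ.2.isInfix⟩, rfl⟩

end PrefixValues

end Tame

end Semigroup

end Concatenation

/-! ### A semantic criterion for interpretations: inner models. -/

namespace FirstOrder.Language

theorem EqualityAxiom.realize {L : Language.{0, 0}} {N : Type} [L.Structure N] {φ : L.Sentence}
    (hφ : EqualityAxiom L φ) : N ⊨ φ := by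
  cases hφ with
  | refl => simp [Sentence.Realize, Formula.Realize]
  | symm =>
    simp only [Sentence.Realize, Formula.Realize, BoundedFormula.realize_all,
      BoundedFormula.realize_imp, BoundedFormula.realize_bdEqual]
    exact fun _ _ h => h.symm
  | trans =>
    simp only [Sentence.Realize, Formula.Realize, BoundedFormula.realize_all,
      BoundedFormula.realize_imp, BoundedFormula.realize_bdEqual]
    exact fun _ _ _ h h' => h.trans h'
  | fn f =>
    simp only [Sentence.Realize, Formula.realize_iAlls, Formula.realize_imp, Formula.realize_iInf,
      Formula.realize_equal, Term.realize_var, Term.realize_func, Sum.elim_inr]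
    exact fun i h => congrArg _ (funext h)
  | rel R =>
    simp only [Sentence.Realize, Formula.realize_iAlls, Formula.realize_imp, Formula.realize_iInf,
      Formula.realize_equal, Term.realize_var, Formula.realize_rel, Sum.elim_inr]
    intro i h
    rw [funext h]
    exact id

namespace RelTranslation

/-- Converts the blocks of quantifiers relativized to the domain, as produced by unnesting, into
quantifiers over the inner model, by choosing preimages under e. -/
theorem exists_tuples_mem_range {M N : Type} {m n : ℕ} (e : N → Fin m → M)
    {P : (Fin n × Fin m → M) → Prop} :
    (∃ i, (∀ k, (fun j => i (k, j)) ∈ Set.range e) ∧ P i) ↔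
      ∃ a : Fin n → N, P fun p => e (a p.1) p.2 := by
  constructor
  · rintro ⟨i, hi, hP⟩
    choose a ha using hi
    refine ⟨a, ?_⟩
    convert hP using 1
    funext p
    exact congrFun (ha p.1) p.2
  · rintro ⟨a, hP⟩
    exact ⟨_, fun k => ⟨a k, rfl⟩, hP⟩

variable {L₁ L₂ : Language.{0, 0}} {τ : RelTranslation L₁ L₂} {M N : Type} [L₁.Structure N]
  [L₂.Structure M]

/-- The `L₁`-structure `N` is, via `e`, the inner model that `τ` defines in `M`. -/
structure IsInnerModel (τ : RelTranslation L₁ L₂) (e : N → Fin τ.dim → M) : Prop where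
  injective : Function.Injective e
  dom : ∀ x, τ.dom.Realize x ↔ x ∈ Set.range e
  eqv : ∀ a : Fin 2 → N, τ.eqv.Realize (fun p => e (a p.1) p.2) ↔ a 0 = a 1
  rel : ∀ {n : ℕ} (R : L₁.Relations n) (a : Fin n → N),
    (τ.rel R).Realize (fun p => e (a p.1) p.2) ↔ Structure.RelMap R a
  fn : ∀ {n : ℕ} (g : L₁.Functions n) (a : Fin n → N) (b : N),
    (τ.fn g).Realize (Sum.elim (fun p => e (a p.1) p.2) (e b)) ↔ b = Structure.funMap g a

namespace IsInnerModel

variable {e : N → Fin τ.dim → M} (he : τ.IsInnerModel e)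
include he

theorem realize_domAt {V : Type} (x : Fin τ.dim → V) (v : V → M) :
    (τ.domAt x).Realize v ↔ (fun j => v (x j)) ∈ Set.range e := by
  rw [domAt, Formula.realize_relabel, he.dom]
  rfl

/-- Function symbols translate to graphs of the inner operations, so by induction the auxiliary
tuples are forced to be the values of the subterms. -/
theorem realize_term {V : Type} (t : L₁.Term V) (v : V → N) (b : N) :
    (τ.term t).Realize (Sum.elim (fun p => e (v p.1) p.2) (e b)) ↔ b = t.realize v := by
  induction t generalizing b with
  | var x =>
    simp only [term, Formula.realize_iInf, Formula.realize_equal, Term.realize_var, Sum.elim_inl,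
      Sum.elim_inr, ← funext_iff]
    exact he.injective.eq_iff
  | @func n g ts ih =>
    simp only [term, Formula.realize_iExs, Formula.realize_inf, Formula.realize_iInf,
      he.realize_domAt, Sum.elim_inr, and_assoc, Formula.realize_relabel]
    rw [exists_tuples_mem_range]
    have key : ∀ a : Fin n → N, ∀ i,
        (Sum.elim (Sum.elim (fun p : V × Fin τ.dim => e (v p.1) p.2) (e b))
          (fun p : Fin n × Fin τ.dim => e (a p.1) p.2)) ∘
          (Sum.elim (fun p => Sum.inl (Sum.inl p)) fun j => Sum.inr (i, j)) =
        Sum.elim (fun p => e (v p.1) p.2) (e (a i)) := by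
      intro a i
      funext x
      rcases x with x | x <;> rfl
    have key' : ∀ a : Fin n → N,
        (Sum.elim (Sum.elim (fun p : V × Fin τ.dim => e (v p.1) p.2) (e b))
          (fun p : Fin n × Fin τ.dim => e (a p.1) p.2)) ∘
            (Sum.elim Sum.inr fun j => Sum.inl (Sum.inr j)) =
        Sum.elim (fun p => e (a p.1) p.2) (e b) := by
      intro a
      funext x
      rcases x with x | x <;> rfl
    simp only [key, key', ih, he.fn, Term.realize_func]
    constructor
    · rintro ⟨a, ha, rfl⟩
      rw [funext ha]
    · rintro rfl
      exact ⟨_, fun i => rfl, rfl⟩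

theorem realize_atomic {V : Type} {n : ℕ} (ψ : L₂.Formula (Fin n × Fin τ.dim))
    (ts : Fin n → L₁.Term V) (v : V → N) :
    (τ.atomic ψ ts).Realize (fun p => e (v p.1) p.2) ↔
      ψ.Realize fun p => e ((ts p.1).realize v) p.2 := by
  simp only [atomic, Formula.realize_iExs, Formula.realize_inf, Formula.realize_iInf,
    he.realize_domAt, Sum.elim_inr, and_assoc, Formula.realize_relabel]
  rw [exists_tuples_mem_range]
  have key : ∀ a : Fin n → N, ∀ i,
      (Sum.elim (fun p : V × Fin τ.dim => e (v p.1) p.2)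
        (fun p : Fin n × Fin τ.dim => e (a p.1) p.2)) ∘
        (Sum.elim Sum.inl fun j => Sum.inr (i, j)) =
      Sum.elim (fun p => e (v p.1) p.2) (e (a i)) := by
    intro a i
    funext x
    rcases x with x | x <;> rfl
  simp only [key, he.realize_term, Sum.elim_comp_inr]
  constructor
  · rintro ⟨a, ha, h⟩
    simpa only [ha] using h
  · exact fun h => ⟨fun i => (ts i).realize v, fun i => rfl, h⟩

/-- The translation of a formula says in `M` what the formula says in the inner model. -/
theorem realize_formula {V : Type} {n : ℕ} (φ : L₁.BoundedFormula V n) (v : V → N)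
    (xs : Fin n → N) :
    (τ.formula φ).Realize (fun p => e (Sum.elim v xs p.1) p.2) ↔ φ.Realize v xs := by
  induction φ with
  | falsum => rfl
  | equal t₁ t₂ =>
    rw [formula, he.realize_atomic, he.eqv fun k => (![t₁, t₂] k).realize _]
    rfl
  | rel R ts =>
    rw [formula, he.realize_atomic, he.rel R fun k => (ts k).realize _]
    rfl
  | imp φ ψ ihφ ihψ =>
    rw [formula, Formula.realize_imp, ihφ, ihψ, BoundedFormula.realize_imp]
  | @all n φ ih =>
    have key : ∀ a : N, (Sum.elim (fun p => e (Sum.elim v xs p.1) p.2) (e a)) ∘ splitLast =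
        fun p => e (Sum.elim v (Fin.snoc xs a : Fin (n + 1) → N) p.1) p.2 := by
      intro a
      funext ⟨x, j⟩
      rcases x with x | i
      · rfl
      · refine Fin.lastCases ?_ (fun i => ?_) i <;> simp [splitLast]
    simp only [formula, Formula.realize_iAlls, Formula.realize_imp, he.realize_domAt, Sum.elim_inr,
      Formula.realize_relabel, BoundedFormula.realize_all]
    constructor
    · intro h a
      have := h (e a) ⟨a, rfl⟩
      rwa [key, ih] at this
    · rintro h y ⟨a, ha⟩
      obtain rfl : e a = y := ha
      rw [key, ih]
      exact h a

theorem realize_sentence (φ : L₁.Sentence) (v : (Empty ⊕ Fin 0) × Fin τ.dim → M) :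
    (τ.formula φ).Realize v ↔ N ⊨ φ := by
  refine Iff.trans ?_ (he.realize_formula φ default default)
  refine iff_of_eq (congrArg _ (funext fun p => ?_))
  rcases p with ⟨x | i, _⟩
  exacts [x.elim, i.elim0]

end IsInnerModel

/-- `τ` interprets `S` in `T` if it defines a model of `S` in every model of `T`. -/
theorem interprets_of_isInnerModel {S : L₁.Theory} {T : L₂.Theory}
    (h : ∀ (M : Type) [L₂.Structure M] [Nonempty M], M ⊨ T →
      ∃ (N : Type) (_ : L₁.Structure N) (e : N → Fin τ.dim → M),
        Nonempty N ∧ τ.IsInnerModel e ∧ N ⊨ S) :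
    τ.Interprets S T where
  dom_nonempty := by
    refine Theory.models_formula_iff.2 fun M v => ?_
    obtain ⟨N, _, e, ⟨a⟩, he, -⟩ := h M M.is_model
    simp only [Formula.realize_iExs, he.realize_domAt, Sum.elim_inr]
    exact ⟨e a, a, rfl⟩
  fn_total := by
    intro n f
    refine Theory.models_formula_iff.2 fun M v => ?_
    obtain ⟨N, _, e, -, he, -⟩ := h M M.is_model
    simp only [Formula.realize_imp, Formula.realize_iInf, he.realize_domAt,
      Formula.realize_iExsUnique, Formula.realize_inf, Sum.elim_inr]
    intro hv
    choose a ha using hv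
    -- Arguments in the domain come from a tuple of the inner model, whose operation supplies the
    -- unique value.
    obtain rfl : v = fun p => e (a p.1) p.2 := funext fun p => (congrFun (ha p.1) p.2).symm
    refine ⟨e (Structure.funMap f a), ⟨⟨_, rfl⟩, (he.fn f a _).2 rfl⟩, ?_⟩
    rintro y ⟨⟨b, hy⟩, hb⟩
    obtain rfl : e b = y := hy
    exact congrArg e ((he.fn f a b).1 hb)
  equality := by
    intro φ hφ
    refine Theory.models_formula_iff.2 fun M v => ?_
    obtain ⟨N, _, e, -, he, -⟩ := h M M.is_model
    exact (he.realize_sentence φ v).2 hφ.realize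
  axioms := by
    intro φ hφ
    refine Theory.models_formula_iff.2 fun M v => ?_
    obtain ⟨N, _, e, -, he, hN⟩ := h M M.is_model
    exact (he.realize_sentence φ v).2 (hN.realize_of_mem φ hφ)

end RelTranslation

end FirstOrder.Language

namespace Concatenation

/-! ### The axioms read algebraically in a structure. -/

section Semantics

variable {L : FirstOrder.Language.{0, 0}} [HasConc L] {M : Type} [L.Structure M] [Mul M]

/-- The symbols `0`, `1`, `∘` are interpreted in `M` by `c` and by multiplication. -/
structure Compatible (L : FirstOrder.Language.{0, 0}) [HasConc L] [L.Structure M]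
    (c : Bool → M) : Prop where
  zero : ∀ a : Fin 0 → M, Structure.funMap (HasConc.sym Func.zero : L.Functions 0) a = c false
  one : ∀ a : Fin 0 → M, Structure.funMap (HasConc.sym Func.one : L.Functions 0) a = c true
  conc : ∀ a : Fin 2 → M, Structure.funMap (HasConc.sym Func.conc : L.Functions 2) a = a 0 * a 1

namespace Compatible

variable {c : Bool → M} (h : Compatible L c)
include h

theorem realize_bit {V : Type} (b : Bool) (v : V → M) : (bit b : L.Term V).realize v = c b := by
  cases b
  · exact h.zero _
  · exact h.one _

theorem realize_cat {V : Type} (s t : L.Term V) (v : V → M) :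
    (cat s t).realize v = s.realize v * t.realize v :=
  h.conc _

theorem realize_biteral {V : Type} (α : BitString) (v : V → M) :
    (biteral α : L.Term V).realize v = value c α := by
  have key : ∀ (l : List Bool) (t : L.Term V),
      (l.foldl (fun t b => cat t (bit b)) t).realize v =
        l.foldl (fun t b => t * c b) (t.realize v) := by
    intro l
    induction l with
    | nil => exact fun _ => rfl
    | cons b l ih =>
      intro t
      rw [List.foldl_cons, List.foldl_cons, ih, h.realize_cat, h.realize_bit]
  rw [biteral, key, h.realize_bit, value]

theorem realize_assoc : M ⊨ assoc L ↔ ∀ x y z : M, x * y * z = x * (y * z) := by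
  simp only [assoc, Sentence.Realize, Formula.Realize, BoundedFormula.realize_all,
    BoundedFormula.realize_bdEqual, h.realize_cat]
  rfl

theorem realize_rightCancel :
    M ⊨ rightCancel L ↔ ∀ x y : M, x ≠ y → x * c false ≠ y * c false ∧ x * c true ≠ y * c true := by
  simp only [rightCancel, Sentence.Realize, Formula.Realize, BoundedFormula.realize_all,
    BoundedFormula.realize_bdEqual, BoundedFormula.realize_imp, BoundedFormula.realize_not,
    BoundedFormula.realize_inf, h.realize_cat, h.realize_bit]
  rfl

theorem realize_rightDistinct :
    M ⊨ rightDistinct L ↔ ∀ x y : M, x * c false ≠ y * c true := by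
  simp only [rightDistinct, Sentence.Realize, Formula.Realize, BoundedFormula.realize_all,
    BoundedFormula.realize_bdEqual, BoundedFormula.realize_not, h.realize_cat, h.realize_bit]
  rfl

theorem realize_leftCancel :
    M ⊨ leftCancel L ↔ ∀ x y : M, x ≠ y → c false * x ≠ c false * y ∧ c true * x ≠ c true * y := by
  simp only [leftCancel, Sentence.Realize, Formula.Realize, BoundedFormula.realize_all,
    BoundedFormula.realize_bdEqual, BoundedFormula.realize_imp, BoundedFormula.realize_not,
    BoundedFormula.realize_inf, h.realize_cat, h.realize_bit]
  rfl

theorem realize_leftDistinct :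
    M ⊨ leftDistinct L ↔ ∀ x y : M, c false * x ≠ c true * y := by
  simp only [leftDistinct, Sentence.Realize, Formula.Realize, BoundedFormula.realize_all,
    BoundedFormula.realize_bdEqual, BoundedFormula.realize_not, h.realize_cat, h.realize_bit]
  rfl

theorem model_base :
    M ⊨ base L ↔ (∀ x y z : M, x * y * z = x * (y * z)) ∧ RightFree c := by
  simp only [base, Theory.model_iff, Set.mem_insert_iff, Set.mem_singleton_iff, forall_eq_or_imp,
    forall_eq, h.realize_assoc, h.realize_rightCancel, h.realize_rightDistinct]
  refine and_congr_right fun _ => ⟨fun ⟨h1, h2⟩ => ⟨fun {x y b} hxy => ?_, h2⟩, fun hc =>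
    ⟨fun x y hxy => ⟨fun h1 => hxy (hc.cancel h1), fun h1 => hxy (hc.cancel h1)⟩, hc.distinct⟩⟩
  by_contra hne
  cases b
  exacts [(h1 x y hne).1 hxy, (h1 x y hne).2 hxy]

theorem model_leftAxioms :
    M ⊨ leftAxioms L ↔
      (∀ x y : M, x ≠ y → c false * x ≠ c false * y ∧ c true * x ≠ c true * y) ∧
        ∀ x y : M, c false * x ≠ c true * y := by
  simp only [leftAxioms, Theory.model_iff, Set.mem_insert_iff, Set.mem_singleton_iff,
    forall_eq_or_imp, forall_eq, h.realize_leftCancel, h.realize_leftDistinct]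

/-- The left axioms are inherited by subalgebras. -/
theorem model_leftAxioms_of_injective {L' : FirstOrder.Language.{0, 0}} [HasConc L'] {N : Type}
    [L'.Structure N] [Mul N] {c' : Bool → N} (h' : Compatible L' c') (f : N → M)
    (hf : Function.Injective f) (hmul : ∀ x y, f (x * y) = f x * f y) (hc : ∀ b, f (c' b) = c b)
    (hM : M ⊨ leftAxioms L) : N ⊨ leftAxioms L' := by
  rw [h.model_leftAxioms] at hM
  refine h'.model_leftAxioms.2 ⟨fun x y hxy => ?_, fun x y hxy => ?_⟩
  · have := hM.1 (f x) (f y) (hf.ne hxy)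
    simp only [← hc, ← hmul] at this
    exact ⟨ne_of_apply_ne f this.1, ne_of_apply_ne f this.2⟩
  · have := hM.2 (f x) (f y)
    simp only [← hc, ← hmul] at this
    exact this (congrArg f hxy)

end Compatible

theorem Compatible.realize_prefixAxiom {M : Type} [LPref.Structure M] [Mul M] {c : Bool → M}
    (h : Compatible LPref c) (α : BitString) :
    M ⊨ prefixAxiom α ↔ ∀ x : M, Structure.RelMap (L := LPref) Rel.pref ![x, value c α] ↔
      ∃ γ : Pref α, x = value c γ.1 := by
  simp only [prefixAxiom, Sentence.Realize, Formula.Realize, BoundedFormula.realize_all,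
    BoundedFormula.realize_iff, BoundedFormula.realize_iSup,
    BoundedFormula.realize_bdEqual, h.realize_biteral]
  refine forall_congr' fun x => iff_congr (BoundedFormula.realize_rel₂.trans ?_) Iff.rfl
  rw [h.realize_biteral]
  rfl

theorem Compatible.realize_substringAxiom {M : Type} [LMinus.Structure M] [Mul M] {c : Bool → M}
    (h : Compatible LMinus c) (α : BitString) :
    M ⊨ substringAxiom α ↔ ∀ x : M, (x = value c α ∨ ∃ u v,
      ((value c α = u * x ∨ value c α = x * v) ∨ value c α = u * x * v)) →
      ∃ γ : Sub α, x = value c γ.1 := by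
  simp only [substringAxiom, substringFormula, Sentence.Realize, Formula.Realize,
    BoundedFormula.realize_all, BoundedFormula.realize_imp, BoundedFormula.realize_sup,
    BoundedFormula.realize_ex, BoundedFormula.realize_iSup,
    BoundedFormula.realize_bdEqual, h.realize_biteral, h.realize_cat]
  rfl

end Semantics

/-- Every structure for a language with `0`, `1`, `∘` is compatible with its own operations. -/
theorem exists_compatible (L : FirstOrder.Language.{0, 0}) [HasConc L] (M : Type) [L.Structure M] :
    ∃ (_ : Mul M) (c : Bool → M), Compatible L c := by
  let _ : Mul M := ⟨fun x y => Structure.funMap (HasConc.sym Func.conc : L.Functions 2) ![x, y]⟩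
  refine ⟨inferInstance, fun b => (bit b : L.Term Empty).realize Empty.elim,
    fun a => congrArg _ (Subsingleton.elim _ _), fun a => congrArg _ (Subsingleton.elim _ _),
    fun a => congrArg _ ?_⟩
  funext i
  fin_cases i <;> rfl

/-- The interpretation of `0`, `1`, `∘` by `c` and multiplication. -/
def funMapOfMul {M : Type} [Mul M] (c : Bool → M) : {n : ℕ} → Func n → (Fin n → M) → M
  | _, .zero, _ => c false
  | _, .one, _ => c true
  | _, .conc, a => a 0 * a 1

theorem Compatible.funMap_eq {L : FirstOrder.Language.{0, 0}} [HasConc L] {M : Type}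
    [L.Structure M] [Mul M] {c : Bool → M} (h : Compatible L c) {n : ℕ} (g : Func n)
    (a : Fin n → M) :
    Structure.funMap (HasConc.sym g : L.Functions n) a = funMapOfMul c g a := by
  cases g
  exacts [h.zero a, h.one a, h.conc a]

theorem map_funMapOfMul {M N : Type} [Mul M] [Mul N] {c : Bool → M} {c' : Bool → N} (f : N → M)
    (hmul : ∀ x y, f (x * y) = f x * f y) (hc : ∀ b, f (c' b) = c b) {n : ℕ} (g : Func n)
    (a : Fin n → N) : f (funMapOfMul c' g a) = funMapOfMul c g (f ∘ a) := by
  cases g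
  exacts [hc _, hc _, hmul _ _]

theorem map_value {M N : Type} [Mul M] [Mul N] {c : Bool → M} {c' : Bool → N} (f : N → M)
    (hmul : ∀ x y, f (x * y) = f x * f y) (hc : ∀ b, f (c' b) = c b) (α : BitString) :
    f (value c' α) = value c α := by
  have key : ∀ (l : List Bool) (x : N),
      f (l.foldl (fun t b => t * c' b) x) = l.foldl (fun t b => t * c b) (f x) := by
    intro l
    induction l with
    | nil => exact fun _ => rfl
    | cons b l ih => intro x; rw [List.foldl_cons, List.foldl_cons, ih, hmul, hc]
  rw [value, key, hc, value]

/-! ### Tameness as a first-order formula. -/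

section Formulas

variable {V : Type}

/-- The weakening of a term by one variable. -/
def weaken {L : FirstOrder.Language.{0, 0}} (t : L.Term V) : L.Term (V ⊕ Unit) := t.relabel Sum.inl

/-- The variable that weakening adds. -/
def fresh {L : FirstOrder.Language.{0, 0}} : L.Term (V ⊕ Unit) := Term.var (Sum.inr ())

/-- Universal quantification of the fresh variable. -/
noncomputable def forallFresh {L : FirstOrder.Language.{0, 0}} (φ : L.Formula (V ⊕ Unit)) :
    L.Formula V := φ.iAlls Unit

/-- Existential quantification of the fresh variable. -/
noncomputable def existsFresh {L : FirstOrder.Language.{0, 0}} (φ : L.Formula (V ⊕ Unit)) :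
    L.Formula V := φ.iExs Unit

section

variable {L : FirstOrder.Language.{0, 0}} {M : Type} [L.Structure M] (v : V → M)

theorem realize_weaken (t : L.Term V) (a : M) :
    (weaken t).realize (Sum.elim v fun _ => a) = t.realize v := by
  rw [weaken, Term.realize_relabel, Sum.elim_comp_inl]

theorem realize_fresh (a : M) :
    (fresh : L.Term (V ⊕ Unit)).realize (Sum.elim v fun _ => a) = a := rfl

theorem realize_forallFresh (φ : L.Formula (V ⊕ Unit)) :
    (forallFresh φ).Realize v ↔ ∀ a : M, φ.Realize (Sum.elim v fun _ => a) := by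
  rw [forallFresh, Formula.realize_iAlls]
  exact ⟨fun h a => h fun _ => a, fun h i => h (i ())⟩

theorem realize_existsFresh (φ : L.Formula (V ⊕ Unit)) :
    (existsFresh φ).Realize v ↔ ∃ a : M, φ.Realize (Sum.elim v fun _ => a) := by
  rw [existsFresh, Formula.realize_iExs]
  exact ⟨fun ⟨i, h⟩ => ⟨i (), h⟩, fun ⟨a, h⟩ => ⟨fun _ => a, h⟩⟩

end

/-- The formula `s ≼ t`. -/
def prefixFormula (s t : LPref.Term V) : LPref.Formula V :=
  Relations.formula₂ (L := LPref) Rel.pref s t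

/-- The formula saying that `t` ends in a letter. -/
noncomputable def endsInLetterFormula (t : LPref.Term V) : LPref.Formula V :=
  Formula.iSup fun b : Bool =>
    Term.equal t (bit b) ⊔ existsFresh (Term.equal (weaken t) (cat fresh (bit b)))

/-- The formula saying that `t` is strippable. -/
noncomputable def strippableFormula (t : LPref.Term V) : LPref.Formula V :=
  prefixFormula t t ⊓ forallFresh ((prefixFormula fresh (weaken t)).imp
    (Formula.iSup fun b : Bool => Term.equal fresh (bit b) ⊔
      existsFresh (prefixFormula fresh (weaken (weaken t)) ⊓
        Term.equal (weaken fresh) (cat fresh (bit b)))))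

/-- The formula saying that `t` is locally regular. -/
noncomputable def locallyRegularFormula (t : LPref.Term V) : LPref.Formula V :=
  forallFresh (forallFresh ((prefixFormula (weaken fresh) (weaken (weaken t))).imp
    ((prefixFormula fresh (weaken fresh)).imp (prefixFormula fresh (weaken (weaken t)))))) ⊓
  (forallFresh ((endsInLetterFormula fresh).imp
    ((Formula.iSup fun b : Bool => Term.equal (weaken t) (cat fresh (bit b))).imp
      (prefixFormula fresh (weaken t)))) ⊓
  forallFresh (forallFresh (forallFresh
    ((Term.equal (weaken (weaken (weaken t)))
      (cat (cat (weaken (weaken fresh)) (weaken fresh)) fresh)).imp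
    ((prefixFormula (cat (weaken (weaken fresh)) (weaken fresh)) (weaken (weaken (weaken t)))).imp
    ((strippableFormula (weaken fresh)).imp ((strippableFormula fresh).imp
      (strippableFormula (cat (weaken fresh) fresh)))))))))

/-- The formula saying that `t` is regular. -/
noncomputable def regularFormula (t : LPref.Term V) : LPref.Formula V :=
  locallyRegularFormula t ⊓
    forallFresh ((prefixFormula fresh (weaken t)).imp (locallyRegularFormula fresh))

/-- The formula saying that `t` is tame. -/
noncomputable def tameFormula (t : LPref.Term V) : LPref.Formula V :=
  endsInLetterFormula t ⊓ forallFresh ((endsInLetterFormula fresh).imp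
    ((regularFormula (cat fresh (weaken t))).imp
      (prefixFormula fresh (cat fresh (weaken t)) ⊓ strippableFormula (weaken t))))

variable {M : Type} [LPref.Structure M]

variable (M) in
/-- The relation that interprets `≼`. -/
def prefixRel (x y : M) : Prop := Structure.RelMap (L := LPref) Rel.pref ![x, y]

theorem realize_prefixFormula (s t : LPref.Term V) (v : V → M) :
    (prefixFormula s t).Realize v ↔ prefixRel M (s.realize v) (t.realize v) :=
  Formula.realize_rel₂

variable [Mul M] {c : Bool → M} (h : Compatible LPref c)
include h

theorem Compatible.realize_endsInLetterFormula (t : LPref.Term V) (v : V → M) :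
    (endsInLetterFormula t).Realize v ↔ EndsInLetter c (t.realize v) := by
  simp only [endsInLetterFormula, Formula.realize_iSup, Formula.realize_sup, Formula.realize_equal,
    realize_existsFresh, h.realize_cat, h.realize_bit, realize_weaken, realize_fresh, EndsInLetter]

theorem Compatible.realize_strippableFormula (t : LPref.Term V) (v : V → M) :
    (strippableFormula t).Realize v ↔ Strippable c (prefixRel M) (t.realize v) := by
  simp only [strippableFormula, Formula.realize_iSup, Formula.realize_sup, Formula.realize_inf,
    Formula.realize_imp, Formula.realize_equal, realize_existsFresh, realize_forallFresh,
    realize_prefixFormula, h.realize_cat, h.realize_bit, realize_weaken, realize_fresh, Strippable]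

theorem Compatible.realize_locallyRegularFormula (t : LPref.Term V) (v : V → M) :
    (locallyRegularFormula t).Realize v ↔ LocallyRegular c (prefixRel M) (t.realize v) := by
  simp only [locallyRegularFormula, Formula.realize_iSup, Formula.realize_inf,
    Formula.realize_imp, Formula.realize_equal, realize_forallFresh, realize_prefixFormula,
    h.realize_endsInLetterFormula, h.realize_strippableFormula,
    h.realize_cat, h.realize_bit, realize_weaken, realize_fresh, LocallyRegular]

theorem Compatible.realize_regularFormula (t : LPref.Term V) (v : V → M) :
    (regularFormula t).Realize v ↔ Regular c (prefixRel M) (t.realize v) := by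
  simp only [regularFormula, Formula.realize_inf, Formula.realize_imp, realize_forallFresh,
    realize_prefixFormula, h.realize_locallyRegularFormula, realize_weaken, realize_fresh, Regular]

theorem Compatible.realize_tameFormula (t : LPref.Term V) (v : V → M) :
    (tameFormula t).Realize v ↔ Tame c (prefixRel M) (t.realize v) := by
  simp only [tameFormula, Formula.realize_inf, Formula.realize_imp, realize_forallFresh,
    realize_prefixFormula, h.realize_endsInLetterFormula, h.realize_regularFormula,
    h.realize_strippableFormula, h.realize_cat, realize_weaken, realize_fresh, Tame]

end Formulas

/-! ### The two translations and their inner models. -/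

section Translations

/-- The graph of a function symbol, as a formula with one variable for each argument. -/
def graphFormula {L : FirstOrder.Language.{0, 0}} [HasConc L] {n : ℕ} (g : Func n) :
    L.Formula ((Fin n × Fin 1) ⊕ Fin 1) :=
  Term.equal (Term.var (Sum.inr 0))
    (Term.func (HasConc.sym g : L.Functions n) fun i => Term.var (Sum.inl (i, 0)))

/-- Equality, as a formula with one variable for each argument. -/
def equalFormula {L : FirstOrder.Language.{0, 0}} : L.Formula (Fin 2 × Fin 1) :=
  Term.equal (Term.var (0, 0)) (Term.var (1, 0))

/-- The formula saying that the second argument is equal to the first one or extends it. -/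
noncomputable def extensionFormula {L : FirstOrder.Language.{0, 0}} [HasConc L] :
    L.Formula (Fin 2 × Fin 1) :=
  equalFormula ⊔
    existsFresh (Term.equal (weaken (Term.var (1, 0))) (cat (weaken (Term.var (0, 0))) fresh))

section

variable {L : FirstOrder.Language.{0, 0}} {M : Type} [L.Structure M]

theorem realize_equalFormula (a : Fin 2 → M) :
    (equalFormula : L.Formula (Fin 2 × Fin 1)).Realize (fun p => a p.1) ↔ a 0 = a 1 :=
  Formula.realize_equal

variable [HasConc L] [Mul M] {c : Bool → M} (h : Compatible L c)
include h

theorem Compatible.realize_graphFormula {n : ℕ} (g : Func n) (a : Fin n → M) (b : M) :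
    (graphFormula g : L.Formula _).Realize (Sum.elim (fun p => a p.1) fun _ => b) ↔
      b = funMapOfMul c g a := by
  rw [graphFormula, Formula.realize_equal, Term.realize_func, h.funMap_eq]
  rfl

theorem Compatible.realize_extensionFormula (a : Fin 2 → M) :
    (extensionFormula : L.Formula _).Realize (fun p => a p.1) ↔
      a 0 = a 1 ∨ ∃ v, a 1 = a 0 * v := by
  rw [extensionFormula, Formula.realize_sup, realize_equalFormula, realize_existsFresh]
  simp only [Formula.realize_equal, h.realize_cat, realize_weaken, realize_fresh, Term.realize_var]

end

/-- The translation that keeps `0`, `1`, `∘` and restricts the domain to the tame elements. -/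
noncomputable def tameTranslation : RelTranslation LMinus LPref where
  dim := 1
  dim_pos := one_pos
  dom := tameFormula (Term.var 0)
  eqv := equalFormula
  rel R := Empty.elim R
  fn g := graphFormula g

/-- The translation that keeps `0`, `1`, `∘` and defines `≼` by concatenation. -/
noncomputable def prefixTranslation : RelTranslation LPref LMinus where
  dim := 1
  dim_pos := one_pos
  dom := ⊤
  eqv := equalFormula
  rel R := match R with
    | .pref => extensionFormula
  fn g := graphFormula g

/-- The tame elements form a subsemigroup containing the letters, so the universal axioms pass to it
and values of strings agree with those in M. Only the substring axiom uses the analysis of factors;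
its quantified factors are now themselves tame. -/
theorem exists_inner_model_IDStar (M : Type) [LPref.Structure M] (hM : M ⊨ ID) :
    ∃ (N : Type) (_ : LMinus.Structure N) (e : N → Fin tameTranslation.dim → M),
      Nonempty N ∧ tameTranslation.IsInnerModel e ∧ N ⊨ IDStar ∧
        (M ⊨ leftAxioms LPref → N ⊨ leftAxioms LMinus) := by
  obtain ⟨_, c, h⟩ := exists_compatible LPref M
  obtain ⟨hbase, hpref⟩ := Theory.model_union_iff.1 hM
  obtain ⟨hassoc, hc⟩ := h.model_base.1 hbase
  let _ : Semigroup M := { mul_assoc := hassoc }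
  have hle : ∀ (α : BitString) (x : M),
      prefixRel M x (value c α) ↔ ∃ γ : Pref α, x = value c γ.1 := fun α =>
    (h.realize_prefixAxiom α).1 (hpref.realize_of_mem _ ⟨α, rfl⟩)
  let N := {x : M // Tame c (prefixRel M) x}
  let c' : Bool → N := fun b => ⟨c b, tame_letter hle b⟩
  let _ : Mul N := ⟨fun x y => ⟨x.1 * y.1, x.2.mul y.2⟩⟩
  let _ : LMinus.Structure N := ⟨funMapOfMul c', fun R => Empty.elim R⟩
  have h' : Compatible LMinus c' := ⟨fun _ => rfl, fun _ => rfl, fun _ => rfl⟩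
  have hval : ∀ α, (value c' α).1 = value c α :=
    map_value Subtype.val (fun _ _ => rfl) (fun _ => rfl)
  refine ⟨N, inferInstance, fun x _ => x.1, ⟨c' false⟩, ⟨?_, ?_, ?_, ?_, ?_⟩, ?_, ?_⟩
  · exact fun x y hxy => Subtype.ext (congrFun hxy (0 : Fin 1))
  · intro x
    refine (h.realize_tameFormula _ _).trans ⟨fun hx => ⟨⟨_, hx⟩, ?_⟩, ?_⟩
    · funext j
      exact congrArg x (Subsingleton.elim (α := Fin 1) _ _)
    · rintro ⟨y, rfl⟩
      exact y.2
  · exact fun a => (realize_equalFormula fun i => (a i).1).trans Subtype.ext_iff.symm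
  · exact fun R => Empty.elim R
  · intro n g a b
    refine (h.realize_graphFormula g (fun i => (a i).1) b.1).trans
      (Iff.trans ?_ Subtype.ext_iff.symm)
    exact iff_of_eq (congrArg _
      (map_funMapOfMul (c' := c') Subtype.val (fun _ _ => rfl) (fun _ => rfl) g a).symm)
  · refine Theory.model_union_iff.2 ⟨h'.model_base.2 ⟨?_, ?_⟩, ?_⟩
    · exact fun x y z => Subtype.ext (hassoc _ _ _)
    · exact ⟨fun hxy => Subtype.ext (hc.cancel (congrArg Subtype.val hxy)),
        fun x y hxy => hc.distinct _ _ (congrArg Subtype.val hxy)⟩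
    · refine Theory.model_iff _ |>.2 ?_
      rintro _ ⟨α, rfl⟩
      refine (h'.realize_substringAxiom α).2 fun x hx => ?_
      have key := x.2.exists_value_of_substring hle hc α ?_
      · obtain ⟨γ, hγ⟩ := key
        exact ⟨γ, Subtype.ext (hγ.trans (hval _).symm)⟩
      · rw [← hval]
        rcases hx with hx | ⟨u, v, (hx | hx) | hx⟩
        · exact Or.inl (congrArg Subtype.val hx)
        · exact Or.inr ⟨u.1, v.1, u.2, v.2, Or.inl (congrArg Subtype.val hx)⟩
        · exact Or.inr ⟨u.1, v.1, u.2, v.2, Or.inr (Or.inl (congrArg Subtype.val hx))⟩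
        · exact Or.inr ⟨u.1, v.1, u.2, v.2, Or.inr (Or.inr (congrArg Subtype.val hx))⟩
  · exact h.model_leftAxioms_of_injective h' Subtype.val Subtype.val_injective
      (fun _ _ => rfl) (fun _ => rfl)

/-- The inner model is M itself with ≼ added as extension on the right, so the only new axioms to
verify are those on prefixes. -/
theorem exists_inner_model_ID (M : Type) [LMinus.Structure M] [Nonempty M] (hM : M ⊨ IDStar) :
    ∃ (N : Type) (_ : LPref.Structure N) (e : N → Fin prefixTranslation.dim → M),
      Nonempty N ∧ prefixTranslation.IsInnerModel e ∧ N ⊨ ID ∧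
        (M ⊨ leftAxioms LMinus → N ⊨ leftAxioms LPref) := by
  obtain ⟨_, c, h⟩ := exists_compatible LMinus M
  obtain ⟨hbase, hsub⟩ := Theory.model_union_iff.1 hM
  obtain ⟨hassoc, hc⟩ := h.model_base.1 hbase
  let _ : Semigroup M := { mul_assoc := hassoc }
  let _ : LPref.Structure M :=
    ⟨funMapOfMul c, fun R a => match R with | .pref => a 0 = a 1 ∨ ∃ v, a 1 = a 0 * v⟩
  have h' : Compatible LPref c := ⟨fun _ => rfl, fun _ => rfl, fun _ => rfl⟩
  refine ⟨M, inferInstance, fun x _ => x, inferInstance, ⟨?_, ?_, ?_, ?_, ?_⟩, ?_, ?_⟩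
  · exact fun x y hxy => congrFun hxy (0 : Fin 1)
  · refine fun x => iff_of_true (Formula.realize_top.2 trivial) ⟨x (0 : Fin 1), ?_⟩
    funext j
    exact congrArg x (Subsingleton.elim (α := Fin 1) _ _)
  · exact realize_equalFormula
  · rintro n ⟨⟩ a
    exact h.realize_extensionFormula a
  · exact h.realize_graphFormula
  · refine Theory.model_union_iff.2 ⟨h'.model_base.2 ⟨hassoc, hc⟩, ?_⟩
    refine Theory.model_iff _ |>.2 ?_
    rintro _ ⟨α, rfl⟩
    refine (h'.realize_prefixAxiom α).2 fun x => ?_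
    refine hc.eq_or_exists_mul_iff (fun α x hx => ?_) α x
    exact (h.realize_substringAxiom α).1 (hsub.realize_of_mem _ ⟨α, rfl⟩) x
      (by simpa only [or_assoc] using hx)
  · exact h.model_leftAxioms_of_injective h' id Function.injective_id
      (fun _ _ => rfl) (fun _ => rfl)

end Translations

end Concatenation

theorem mainTheorem3 :
    MutuallyInterpretable Concatenation.IDBar Concatenation.IDBarStar ∧
    (∃ τ : RelTranslation Concatenation.LMinus Concatenation.LPref,
      τ.Interprets Concatenation.IDStar Concatenation.ID ∧
      τ.Interprets Concatenation.IDBarStar Concatenation.IDBar) ∧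
    (∃ σ : RelTranslation Concatenation.LPref Concatenation.LMinus,
      σ.Interprets Concatenation.ID Concatenation.IDStar ∧
      σ.Interprets Concatenation.IDBar Concatenation.IDBarStar) := by
  have h₁ : Concatenation.tameTranslation.Interprets Concatenation.IDStar Concatenation.ID :=
    RelTranslation.interprets_of_isInnerModel fun M _ _ hM => by
      obtain ⟨N, hN, e, h1, h2, h3, -⟩ := Concatenation.exists_inner_model_IDStar M hM
      exact ⟨N, hN, e, h1, h2, h3⟩
  have h₂ : Concatenation.tameTranslation.Interprets Concatenation.IDBarStar
      Concatenation.IDBar :=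
    RelTranslation.interprets_of_isInnerModel fun M _ _ hM => by
      -- The inner model is built from the `ID` part alone; the left axioms are then transferred to
      -- it.
      obtain ⟨hM, hleft⟩ := Theory.model_union_iff.1 hM
      obtain ⟨N, hN, e, h1, h2, h3, h4⟩ := Concatenation.exists_inner_model_IDStar M hM
      exact ⟨N, hN, e, h1, h2, Theory.model_union_iff.2 ⟨h3, h4 hleft⟩⟩
  have h₃ : Concatenation.prefixTranslation.Interprets Concatenation.ID Concatenation.IDStar :=
    RelTranslation.interprets_of_isInnerModel fun M _ _ hM => by
      obtain ⟨N, hN, e, h1, h2, h3, -⟩ := Concatenation.exists_inner_model_ID M hM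
      exact ⟨N, hN, e, h1, h2, h3⟩
  have h₄ : Concatenation.prefixTranslation.Interprets Concatenation.IDBar
      Concatenation.IDBarStar :=
    RelTranslation.interprets_of_isInnerModel fun M _ _ hM => by
      obtain ⟨hM, hleft⟩ := Theory.model_union_iff.1 hM
      obtain ⟨N, hN, e, h1, h2, h3, h4⟩ := Concatenation.exists_inner_model_ID M hM
      exact ⟨N, hN, e, h1, h2, Theory.model_union_iff.2 ⟨h3, h4 hleft⟩⟩
  exact ⟨⟨⟨_, h₄⟩, ⟨_, h₂⟩⟩, ⟨_, h₁, h₂⟩, ⟨_, h₃, h₄⟩⟩
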